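/- Let $V$ be a finite set of users, $E$ a set of directed arcs on $V$ ($(v,u)\in E$ means that $u$ receives the tweets of $v$, i.e. $u$ follows $v$), and let $u_0\notin V$ be a further user. For each $v\in V$ let $r_v\in[0,1]$ be the probability that $v$ follows $u_0$ back if $u_0$ follows $v$. Call the in-neighbours of $v$ in $(V,E)$ together with $u_0$ the potential sources of $v$, and for a potential source $u$ and a set $S$ of potential sources let $p_v(u,S)\in[0,1]$ be the probability that an attempt of $u$ to make $v$ retweet succeeds when the nodes of $S$ have already attempted. Assume that the cascade is order independent (for every $v$ and every set $S$ of potential sources that have already attempted, the probability that the attempts on $v$ by the nodes of a further set all fail does not depend on their order) and decreasing ($p_v(u,S)\ge p_v(u,T)$ for $S\subseteq T$ and $u\notin T$). When $u_0$ follows the users of $B\subseteq V$, each $v\in B$ independently follows $u_0$ back with probability $r_v$, which adds the arc $(u_0,v)$ to the graph. The graph is then doubled: for each user $u\in V$ a reader node $u''$ is added, with an arc $(u,u'')$ and an arc $(v,u'')$ for each arc $(v,u)$ (including $v=u_0$). The success probabilities are $\tilde p_v=p_v$ for $v\in V$ and $\tilde p_{u''}=1$ for the reader nodes. Node $u_0$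 is activated at time $0$. At each time step, the nodes that became active in the previous step make one attempt on each of their inactive out-neighbours, in an arbitrary order, all attempts being realised with independent randomness; the process runs until no new node becomes active. Let $X_v$ be the indicator that node $v$ is active at the end, let $w_{u''}=1$ for the reader nodes and $w_v=0$ for $v\in V\cup\{u_0\}$, and let $\psi(B)=\sum_v w_vX_v$, the number of users in $V$ that see the tweet. Then $B\mapsto\mathbb E[\psi(B)]$ is submodular: for all $B_1\subseteq B_2\subseteq V$ and all $z\in V$, $$\mathbb E[\psi(B_1\cup\{z\})]-\mathbb E[\psi(B_1)]\ \ge\ \mathbb E[\psi(B_2\cup\{z\})]-\mathbb E[\psi(B_2)].$$ -/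

import Mathlib

open scoped unitInterval

namespace Cascade

/-! ### Independent Bernoulli choices -/

section Bernoulli

variable {N : Type*} [DecidableEq N]

/-- The probability that a random subset of `s`, containing each `v ∈ s` independently with
probability `q v`, is equal to `D`. -/
noncomputable def bernoulliWeight (s : Finset N) (q : N → I) (D : Finset N) : ENNReal :=
  if D ⊆ s then
    (∏ v ∈ D, (unitInterval.toNNReal (q v) : ENNReal)) *
      ∏ v ∈ s \ D, (unitInterval.toNNReal (σ (q v)) : ENNReal)
  else 0

theorem sum_bernoulliWeight (s : Finset N) (q : N → I) :
    ∑ D ∈ s.powerset, bernoulliWeight s q D = 1 := by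
  have h := Finset.prod_add (fun v => (unitInterval.toNNReal (q v) : ENNReal))
    (fun v => (unitInterval.toNNReal (σ (q v)) : ENNReal)) s
  have h1 : ∏ v ∈ s, ((unitInterval.toNNReal (q v) : ENNReal) +
      (unitInterval.toNNReal (σ (q v)) : ENNReal)) = 1 := by
    refine Finset.prod_eq_one fun v _ => ?_
    rw [← ENNReal.coe_add, unitInterval.toNNReal_add_toNNReal_symm, ENNReal.coe_one]
  rw [← h1, h]
  refine Finset.sum_congr rfl fun D hD => ?_
  rw [bernoulliWeight, if_pos (Finset.mem_powerset.1 hD)]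

/-- The law of the random subset of `s` that contains each `v ∈ s` independently with
probability `q v`. -/
noncomputable def bernoulliSubset (s : Finset N) (q : N → I) : PMF (Finset N) :=
  PMF.ofFinset (bernoulliWeight s q) s.powerset (sum_bernoulliWeight s q) fun D hD => by
    rw [bernoulliWeight, if_neg (fun h => hD (Finset.mem_powerset.2 h))]

end Bernoulli

/-! ### The order independent cascade model on a finite directed graph -/

section Model

/-- Success probabilities: `p v u S` is the probability that an attempt of `u` to influence `v`
succeeds when the nodes of `S` have already attempted to influence `v`. -/
abbrev SuccessProb (N : Type*) := N → N → Finset N → I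

variable {N : Type*} [Fintype N] [DecidableEq N]

open Classical in
/-- The nodes that have an arc to `v`. -/
noncomputable def inNbrs (G : Digraph N) (v : N) : Finset N :=
  Finset.univ.filter fun u => G.Adj u v

/-- The probability that all the attempts on `v` by the nodes of a list, made in the order of the
list, fail when the nodes of `S` have attempted before. -/
def failProb (p : SuccessProb N) (v : N) : Finset N → List N → I
  | _, [] => 1
  | S, u :: l => σ (p v u S) * failProb p v (insert u S) l

/-- Order independence: the probability that a set of neighbours of `v` fails to influence `v`
does not depend on the order in which they make their attempts. -/
def OrderIndependent (G : Digraph N) (p : SuccessProb N) : Prop :=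
  ∀ (v : N) (S : Finset N) (l l' : List N), S ⊆ inNbrs G v → l.Nodup →
    (∀ u ∈ l, u ∈ inNbrs G v ∧ u ∉ S) → l.Perm l' → failProb p v S l = failProb p v S l'

/-- Decreasing cascade: the success probability `p v u S` is non-increasing in the set `S` of the
neighbours of `v` that have already attempted. -/
def Decreasing (G : Digraph N) (p : SuccessProb N) : Prop :=
  ∀ (v u : N) (S T : Finset N), S ⊆ T → T ⊆ inNbrs G v → u ∈ inNbrs G v → u ∉ T →
    p v u T ≤ p v u S

/-- A rule fixing the order of simultaneous attempts: when `A` is the set of active nodes and `C`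
the set of contagious nodes, `order v A C` lists the nodes of `C` in the order in which
they are considered for their attempts on `v`. -/
structure AttemptOrder (N : Type*) where
  order : N → Finset N → Finset N → List N
  nodup : ∀ v A C, (order v A C).Nodup
  mem_iff : ∀ v A C u, u ∈ order v A C ↔ u ∈ C

/-- The probability that `v`, inactive so far, is activated in the current step, when `A` is the set
of active nodes and `C ⊆ A` the set of those that became active in the last step. The
neighbours of `v` in `A \ C` have attempted before, those in `C` attempt now. -/
noncomputable def activationProb (G : Digraph N) (p : SuccessProb N) (o : AttemptOrder N)
    (A C : Finset N) (v : N) : I :=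
  σ (failProb p v (inNbrs G v ∩ (A \ C)) ((o.order v A C).filter (· ∈ inNbrs G v)))

/-- One step of the cascade, on pairs (active nodes, contagious nodes). -/
noncomputable def step (G : Digraph N) (p : SuccessProb N) (o : AttemptOrder N)
    (s : Finset N × Finset N) : PMF (Finset N × Finset N) :=
  (bernoulliSubset s.1ᶜ (activationProb G p o s.1 s.2)).map fun D => (s.1 ∪ D, D)

/-- The law of the state of the cascade at time `t`, when the nodes of `A` are activated at
time `0`. -/
noncomputable def stateLaw (G : Digraph N) (p : SuccessProb N) (o : AttemptOrder N)
    (A : Finset N) : ℕ → PMF (Finset N × Finset N)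
  | 0 => PMF.pure (A, A)
  | t + 1 => (stateLaw G p o A t).bind (step G p o)

/-- The law of the set of active nodes when the cascade started from `A` has terminated (which
happens after fewer steps than there are nodes, or at once). -/
noncomputable def finalLaw (G : Digraph N) (p : SuccessProb N) (o : AttemptOrder N)
    (A : Finset N) : PMF (Finset N) :=
  (stateLaw G p o A (Fintype.card N)).map Prod.fst

end Model

/-! ### Followings, reciprocation and readers -/

section Readers

variable {V : Type*} [Fintype V] [DecidableEq V]

/-- The social graph `E` on the users `V`, extended by the distinguished user `u₀ = none`, when `R`
is the set of users that follow `u₀`. Arcs go in the direction of propagation. Arcs into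
`u₀` are left out: `u₀` is active from the start. -/
def withSource (E : Digraph V) (R : Finset V) : Digraph (Option V) where
  Adj
    | some u, some v => E.Adj u v
    | none, some v => v ∈ R
    | _, none => False

/-- The doubled graph: the node `inl v` is `v` in its role of a retweeter, and for each user
`u : V` there is a reader node `inr u` with an arc from `u` and from each node with an arc to `u`. -/
def doubledGraph (G : Digraph (Option V)) : Digraph (Option V ⊕ V) where
  Adj
    | .inl t, .inl v => G.Adj t v
    | .inl t, .inr u => t = some u ∨ G.Adj t (some u)
    | .inr _, _ => False

/-- Success probabilities on the doubled graph: those of `p` among the retweeters, and `1` towards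
readers. (There is no arc from a reader to a retweeter; the value `0` is never used.) -/
def doubledProb (p : SuccessProb (Option V)) : SuccessProb (Option V ⊕ V)
  | .inl v, .inl t, S => p v t S.toLeft
  | .inl _, .inr _, _ => 0
  | .inr _, _, _ => 1

/-- The weights: `0` for retweeters, `1` for readers. -/
def weight : Option V ⊕ V → ℝ
  | .inl _ => 0
  | .inr _ => 1

/-- The law of the final set of active nodes of the doubled graph when `u₀` follows the users
of `B`: each `v ∈ B` follows back independently with probability `r v`, then `u₀` emits a tweet and
the cascade evolves. -/
noncomputable def activeLaw (E : Digraph V) (p : SuccessProb (Option V)) (r : V → I)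
    (o : AttemptOrder (Option V ⊕ V)) (B : Finset V) : PMF (Finset (Option V ⊕ V)) :=
  (bernoulliSubset B r).bind fun R =>
    finalLaw (doubledGraph (withSource E R)) (doubledProb p) o {.inl none}

/-- The weighted number of active nodes, `∑ v, w v * X v` with `X v` the indicator that `v` is
active. -/
noncomputable def weightedCount (F : Finset (Option V ⊕ V)) : ℝ :=
  ∑ v, weight v * (if v ∈ F then 1 else 0)

/-- The expected number of users that see the tweet when `u₀` follows the users of `B`. -/
noncomputable def expectedReaders (E : Digraph V) (p : SuccessProb (Option V)) (r : V → I)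
    (o : AttemptOrder (Option V ⊕ V)) (B : Finset V) : ℝ :=
  ∑ F, (activeLaw E p r o B F).toReal * weightedCount F

end Readers

/-- Submodularity: marginal gains are non-increasing in the set. -/
def IsSubmodular {V : Type*} [DecidableEq V] (f : Finset V → ℝ) : Prop :=
  ∀ (S T : Finset V) (z : V), S ⊆ T → f (insert z T) - f T ≤ f (insert z S) - f S

end Cascade

/-!
In an order independent decreasing cascade the expected weight of the final active set is a
submodular function of the seed set (Kempe, Kleinberg and Tardos). For a graph with followers `R` of
`u₀`, the arcs from `u₀` can be replaced by seeds: split `u₀` into copies, one for each possible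
target, and activate those that belong to the arcs present for `R` (`pmfExp_finalLaw_eq_value`). The
expected number of readers is then submodular and monotone in `R`, and averaging over the
independent choices of the users to follow back preserves this (`isSubmodular_subsetExp`).

The seed result rests on three facts about `FailureModel.value G D A`, the expectation of `G` at the
final active set when the nodes of `A` are active and those of `D ⊆ A` have made their attempts.

* Attempts may be made in any order (`FailureModel.value_eq_of_subset`), since the union of two
  independent random sets of newly influenced nodes has the failure probabilities of the combined
  attempts (`subsetExp_union`). Hence additional seeds `W` may wait until the cascade from `A` has
  ended in a set `T`, so that their marginal gain is the expectation, over `T`, of the gain of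
  starting from `T ∪ W` when the nodes of `T` have attempted (`FailureModel.value_union`).
* This gain is antitone in `T`, by a coupling of two cascades
  (`FailureModel.value_sub_le_value_sub`); this is where the decreasing property enters.
* Enlarging the seed set enlarges the final set `T`, again by letting the additional seeds wait.

The expectations over `PMF`s of the definition are turned into `value` by reading the forward
evolution of the law of the state backwards (`pmfExp_stateLaw`).
-/

namespace Cascade

/-! ### Expectations over random subsets with independent elements -/

section SubsetExp

variable {N : Type*} [DecidableEq N]

/-- The expectation of `F S`, where the random set `S ⊆ s` contains each `v ∈ s` independently with
probability `q v`. -/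
noncomputable def subsetExp (s : Finset N) (q : N → ℝ) (F : Finset N → ℝ) : ℝ :=
  ∑ S ∈ s.powerset, ((∏ v ∈ S, q v) * ∏ v ∈ s \ S, (1 - q v)) * F S

theorem subsetExp_empty (q : N → ℝ) (F : Finset N → ℝ) : subsetExp ∅ q F = F ∅ := by
  simp [subsetExp]

theorem subsetExp_insert {s : Finset N} {a : N} (ha : a ∉ s) (q : N → ℝ) (F : Finset N → ℝ) :
    subsetExp (insert a s) q F =
      (1 - q a) * subsetExp s q F + q a * subsetExp s q fun S => F (insert a S) := by
  unfold subsetExp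
  rw [Finset.sum_powerset_insert ha, Finset.mul_sum, Finset.mul_sum]
  congr 1 <;> refine Finset.sum_congr rfl fun S hS => ?_ <;>
    have haS : a ∉ S := fun h => ha (Finset.mem_powerset.1 hS h)
  · rw [Finset.insert_sdiff_of_notMem _ haS,
      Finset.prod_insert fun h => ha (Finset.mem_sdiff.1 h).1]
    ring
  · rw [Finset.prod_insert haS, Finset.insert_sdiff_insert, Finset.sdiff_insert_of_notMem ha]
    ring

theorem subsetExp_add (s : Finset N) (q : N → ℝ) (F F' : Finset N → ℝ) :
    subsetExp s q (fun S => F S + F' S) = subsetExp s q F + subsetExp s q F' := by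
  simp only [subsetExp, mul_add, Finset.sum_add_distrib]

theorem subsetExp_sub (s : Finset N) (q : N → ℝ) (F F' : Finset N → ℝ) :
    subsetExp s q (fun S => F S - F' S) = subsetExp s q F - subsetExp s q F' := by
  simp only [subsetExp, mul_sub, Finset.sum_sub_distrib]

theorem subsetExp_const_mul (s : Finset N) (q : N → ℝ) (c : ℝ) (F : Finset N → ℝ) :
    subsetExp s q (fun S => c * F S) = c * subsetExp s q F := by
  simp only [subsetExp, Finset.mul_sum]
  exact Finset.sum_congr rfl fun S _ => by ring

theorem subsetExp_const (s : Finset N) (q : N → ℝ) (c : ℝ) :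
    subsetExp s q (fun _ => c) = c := by
  induction s using Finset.induction_on with
  | empty => exact subsetExp_empty _ _
  | insert a s ha ih => rw [subsetExp_insert ha, ih]; ring

theorem subsetExp_mono {s : Finset N} {q : N → ℝ} (h0 : ∀ v, 0 ≤ q v) (h1 : ∀ v, q v ≤ 1)
    {F F' : Finset N → ℝ} (h : ∀ S, F S ≤ F' S) : subsetExp s q F ≤ subsetExp s q F' := by
  unfold subsetExp
  refine Finset.sum_le_sum fun S _ => mul_le_mul_of_nonneg_left (h S) ?_
  exact mul_nonneg (Finset.prod_nonneg fun v _ => h0 v)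
    (Finset.prod_nonneg fun v _ => sub_nonneg.2 (h1 v))

theorem subsetExp_congr_prob {s : Finset N} {q q' : N → ℝ} (h : ∀ v ∈ s, q v = q' v)
    (F : Finset N → ℝ) : subsetExp s q F = subsetExp s q' F := by
  unfold subsetExp
  refine Finset.sum_congr rfl fun S hS => ?_
  rw [Finset.prod_congr rfl fun v hv => h v (Finset.mem_powerset.1 hS hv),
    Finset.prod_congr rfl fun v hv => congrArg (1 - ·) (h v (Finset.mem_sdiff.1 hv).1)]

/-- The union of two independent random sets is again a random set with independent elements; the
probabilities of absence multiply. -/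
theorem subsetExp_union (s : Finset N) (q q' : N → ℝ) (F : Finset N → ℝ) :
    subsetExp s q (fun S => subsetExp s q' fun S' => F (S ∪ S')) =
      subsetExp s (fun v => 1 - (1 - q v) * (1 - q' v)) F := by
  induction s using Finset.induction_on generalizing F with
  | empty => simp [subsetExp_empty]
  | insert a s ha ih =>
    have ih' := ih fun S => F (insert a S)
    simp only [subsetExp_insert ha, Finset.insert_union, Finset.union_insert, Finset.insert_idem,
      subsetExp_add, subsetExp_const_mul, ih, ih']
    ring

/-- Monotone coupling: raising the probabilities of the elements enlarges the random set. -/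
theorem subsetExp_le_subsetExp {s : Finset N} {q q' : N → ℝ} (h0 : ∀ v, 0 ≤ q v)
    (hq : ∀ v, q v ≤ q' v) (h1 : ∀ v, q' v ≤ 1) {F F' : Finset N → ℝ}
    (h : ∀ S S', S ⊆ S' → F S ≤ F' S') : subsetExp s q F ≤ subsetExp s q' F' := by
  -- The larger set is the union of the smaller one and an independent set with probabilities `t`.
  -- If `q v = 1`, then `q' v = 1`, and the value `t v = 0` of the division is right.
  set t : N → ℝ := fun v => (q' v - q v) / (1 - q v) with ht
  have ht0 : ∀ v, 0 ≤ t v := fun v =>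
    div_nonneg (sub_nonneg.2 (hq v)) (sub_nonneg.2 ((hq v).trans (h1 v)))
  have ht1 : ∀ v, t v ≤ 1 := fun v =>
    div_le_one_of_le₀ (by linarith [h1 v]) (sub_nonneg.2 ((hq v).trans (h1 v)))
  have hqt : q' = fun v => 1 - (1 - q v) * (1 - t v) := by
    funext v
    rcases eq_or_ne (1 - q v) 0 with h' | h'
    · rw [h', zero_mul]; linarith [hq v, h1 v]
    · simp only [ht]; field_simp; ring
  rw [hqt, ← subsetExp_union]
  refine subsetExp_mono h0 (fun v => (hq v).trans (h1 v)) fun S => ?_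
  rw [← subsetExp_const s t (F S)]
  exact subsetExp_mono ht0 ht1 fun S' => h S _ Finset.subset_union_left

/-- Elements whose presence does not affect `F` can be left out. -/
theorem subsetExp_sdiff (s A : Finset N) (q : N → ℝ) (F : Finset N → ℝ) :
    subsetExp (s \ A) q (fun S => F (A ∪ S)) = subsetExp s q fun S => F (A ∪ S) := by
  induction s using Finset.induction_on generalizing F with
  | empty => simp
  | insert a s ha ih =>
    by_cases haA : a ∈ A
    · have h : ∀ S, A ∪ insert a S = A ∪ S := fun S => by
        rw [Finset.union_insert, Finset.insert_eq_of_mem (Finset.mem_union_left _ haA)]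
      rw [Finset.insert_sdiff_of_mem _ haA, subsetExp_insert ha, ih]
      simp only [h]; ring
    · have ih' := ih fun S => F (insert a S)
      rw [Finset.insert_sdiff_of_notMem _ haA,
        subsetExp_insert fun h => ha (Finset.mem_sdiff.1 h).1, subsetExp_insert ha, ih]
      simp only [Finset.union_insert, ih']

theorem subsetExp_union_of_eq_zero (s t : Finset N) {q : N → ℝ} (h : ∀ v ∈ t, q v = 0)
    (F : Finset N → ℝ) : subsetExp (t ∪ s) q F = subsetExp s q F := by
  induction t using Finset.induction_on with
  | empty => simp
  | insert a t ha ih =>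
    have ih' := ih fun v hv => h v (Finset.mem_insert_of_mem hv)
    rw [Finset.insert_union]
    by_cases has : a ∈ t ∪ s
    · rw [Finset.insert_eq_of_mem has, ih']
    · rw [subsetExp_insert has, h a (Finset.mem_insert_self _ _), ih']; ring

theorem subsetExp_eq_of_eq_zero {s : Finset N} {q : N → ℝ} (h : ∀ v ∈ s, q v = 0)
    (F : Finset N → ℝ) : subsetExp s q F = F ∅ := by
  rw [← Finset.union_empty s, subsetExp_union_of_eq_zero ∅ s h, subsetExp_empty]

theorem subsetExp_map {M : Type*} [DecidableEq M] (e : N ↪ M) (s : Finset N) (q : M → ℝ)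
    (F : Finset M → ℝ) :
    subsetExp (s.map e) q F = subsetExp s (q ∘ e) fun S => F (S.map e) := by
  induction s using Finset.induction_on generalizing F with
  | empty => simp [subsetExp_empty]
  | insert a s ha ih =>
    rw [Finset.map_insert, subsetExp_insert (by simpa using ha), subsetExp_insert ha, ih, ih]
    simp only [Finset.map_insert, Function.comp]

theorem subsetExp_anti {s t : Finset N} (hst : s ⊆ t) {q : N → ℝ} (h0 : ∀ v, 0 ≤ q v)
    (h1 : ∀ v, q v ≤ 1) {F : Finset N → ℝ} (hF : Antitone F) :
    subsetExp t q F ≤ subsetExp s q F := by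
  rw [← Finset.sdiff_union_of_subset hst]
  generalize t \ s = u
  induction u using Finset.induction_on with
  | empty => simp
  | insert a u _ ih =>
    rw [Finset.insert_union]
    by_cases has : a ∈ u ∪ s
    · rwa [Finset.insert_eq_of_mem has]
    · refine le_trans ?_ ih
      rw [subsetExp_insert has]
      have := subsetExp_mono (s := u ∪ s) h0 h1
        fun S => hF (show S ≤ insert a S from Finset.subset_insert a S)
      nlinarith [mul_le_mul_of_nonneg_left this (h0 a)]

/-- Averaging over an independent random choice of elements preserves submodularity. The definition
of `IsSubmodular` with `z ∈ T` says that `f` is monotone as well. -/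
theorem isSubmodular_subsetExp {q : N → ℝ} (h0 : ∀ v, 0 ≤ q v) (h1 : ∀ v, q v ≤ 1)
    {f : Finset N → ℝ} (hf : IsSubmodular f) : IsSubmodular fun B => subsetExp B q f := by
  have key : ∀ z : N, Antitone fun R => f (insert z R) - f R := fun z S T h => hf S T z h
  have hpos : ∀ z R, 0 ≤ f (insert z R) - f R := fun z R => by
    have := hf R (insert z R) z (Finset.subset_insert z R)
    rwa [Finset.insert_idem, sub_self] at this
  have gain : ∀ (B : Finset N) (z : N), z ∉ B → subsetExp (insert z B) q f - subsetExp B q f =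
      q z * subsetExp B q fun R => f (insert z R) - f R := fun B z hz => by
    rw [subsetExp_insert hz, subsetExp_sub]; ring
  intro S T z hST
  by_cases hzT : z ∈ T
  · simp only [Finset.insert_eq_of_mem hzT, sub_self]
    by_cases hzS : z ∈ S
    · simp [Finset.insert_eq_of_mem hzS]
    · rw [gain S z hzS]
      refine mul_nonneg (h0 z) ?_
      rw [← subsetExp_const S q 0]
      exact subsetExp_mono h0 h1 fun R => hpos z R
  · simp only
    rw [gain S z fun h => hzT (hST h), gain T z hzT]
    exact mul_le_mul_of_nonneg_left (subsetExp_anti hST h0 h1 (key z)) (h0 z)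

end SubsetExp

/-! ### The cascade as a function of failure probabilities -/

section Value

variable {M : Type*} [Fintype M] [DecidableEq M]

/-- The expectation of `G A'`, with `A'` the set of active nodes after `n` further steps of the
cascade, when the nodes of `A` are active and those of `D ⊆ A` have made their attempts. Here
`h v D A` is the probability that the attempts on `v` by the nodes of `A \ D` all fail, given that
those of `D` have attempted before. Attempts on active nodes are allowed and have no effect. -/
noncomputable def expAfter (h : M → Finset M → Finset M → ℝ) (G : Finset M → ℝ) :
    ℕ → Finset M → Finset M → ℝ
  | 0, _, A => G A
  | n + 1, D, A => subsetExp Finset.univ (fun v => 1 - h v D A) fun S => expAfter h G n A (A ∪ S)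

theorem expAfter_self {h : M → Finset M → Finset M → ℝ} (hself : ∀ v D, h v D D = 1)
    (G : Finset M → ℝ) (n : ℕ) (D : Finset M) : expAfter h G n D D = G D := by
  induction n with
  | zero => rfl
  | succ n ih =>
    rw [expAfter, subsetExp_eq_of_eq_zero fun v _ => by rw [hself, sub_self], Finset.union_empty,
      ih]

theorem card_compl_lt_of_ssubset {D A : Finset M} (h : D ⊂ A) : Aᶜ.card < Dᶜ.card :=
  Finset.card_lt_card (compl_lt_compl_iff_lt.2 h)

/-- The cascade terminates: each step that is not the last one makes attempts by new nodes. -/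
theorem expAfter_succ_eq {h : M → Finset M → Finset M → ℝ} (hself : ∀ v D, h v D D = 1)
    (G : Finset M → ℝ) (n : ℕ) {D A : Finset M} (hDA : D ⊆ A) (hn : Dᶜ.card ≤ n) :
    expAfter h G (n + 1) D A = expAfter h G n D A := by
  induction n generalizing D A with
  | zero =>
    have hD : D = Finset.univ := by simpa using hn
    obtain rfl : A = D := (hDA.antisymm (hD ▸ Finset.subset_univ A)).symm
    rw [expAfter_self hself, expAfter_self hself]
  | succ n ih =>
    rcases eq_or_ne D A with rfl | hne
    · rw [expAfter_self hself, expAfter_self hself]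
    · have hlt := card_compl_lt_of_ssubset (hDA.ssubset_of_ne hne)
      rw [expAfter, expAfter]
      congr 1
      funext S
      exact ih Finset.subset_union_left (by omega)

theorem expAfter_eq_of_le {h : M → Finset M → Finset M → ℝ} (hself : ∀ v D, h v D D = 1)
    (G : Finset M → ℝ) {n m : ℕ} {D A : Finset M} (hDA : D ⊆ A) (hn : Dᶜ.card ≤ n) (hnm : n ≤ m) :
    expAfter h G m D A = expAfter h G n D A := by
  induction m, hnm using Nat.le_induction with
  | base => rfl
  | succ m hm ih => rw [expAfter_succ_eq hself G m hDA (hn.trans hm), ih]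

/-- Conditional failure probabilities of an order independent decreasing cascade: `fail v D A` is
the probability that the attempts on `v` by the nodes of `A \ D` all fail, given that the attempts
by the nodes of `D ⊆ A` have been made. Order independence is expressed by the chain rule `fail_mul`
for this function of sets, and the decreasing property by `fail_mono`. -/
structure FailureModel (M : Type*) [DecidableEq M] where
  fail : M → Finset M → Finset M → ℝ
  fail_nonneg : ∀ v D A, 0 ≤ fail v D A
  fail_le_one : ∀ v D A, fail v D A ≤ 1
  fail_self : ∀ v D, fail v D D = 1
  fail_mul : ∀ v {D B A}, D ⊆ B → B ⊆ A → fail v D B * fail v B A = fail v D A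
  fail_mono : ∀ v {D D' X}, D ⊆ D' → Disjoint X D' → fail v D (D ∪ X) ≤ fail v D' (D' ∪ X)

namespace FailureModel

section

variable {M : Type*} [DecidableEq M] (m : FailureModel M)

theorem one_sub_fail_nonneg (v : M) (D A : Finset M) : 0 ≤ 1 - m.fail v D A :=
  sub_nonneg.2 (m.fail_le_one v D A)

theorem one_sub_fail_le_one (v : M) (D A : Finset M) : 1 - m.fail v D A ≤ 1 :=
  sub_le_self _ (m.fail_nonneg v D A)

end

variable (m : FailureModel M)

/-- The expectation of `G` at the final set of active nodes, when the nodes of `A` are active and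
those of `D ⊆ A` have made their attempts. -/
noncomputable def value (G : Finset M → ℝ) (D A : Finset M) : ℝ :=
  expAfter m.fail G (Fintype.card M) D A

theorem value_self (G : Finset M → ℝ) (D : Finset M) : m.value G D D = G D :=
  expAfter_self m.fail_self G _ D

theorem value_eq (G : Finset M → ℝ) {D A : Finset M} (h : D ⊆ A) :
    m.value G D A =
      subsetExp Finset.univ (fun v => 1 - m.fail v D A) fun S => m.value G A (A ∪ S) :=
  (expAfter_succ_eq m.fail_self G _ h (Finset.card_le_univ _)).symm

/-- Two successive rounds of attempts, drawn independently, amount to one round. -/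
theorem subsetExp_fail_union (F : Finset M → ℝ) {D B A : Finset M} (h : D ⊆ B) (h' : B ⊆ A) :
    subsetExp Finset.univ (fun v => 1 - m.fail v D A) F =
      subsetExp Finset.univ (fun v => 1 - m.fail v D B) fun S =>
        subsetExp Finset.univ (fun v => 1 - m.fail v B A) fun S' => F (S ∪ S') := by
  rw [subsetExp_union]
  refine subsetExp_congr_prob (fun v _ => ?_) F
  rw [sub_sub_cancel, sub_sub_cancel, m.fail_mul v h h']

/-- The attempts may be made in any order: here the nodes of `B \ D` go first, and those of `A \ B`
join the nodes that were activated by them. -/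
theorem value_eq_of_subset (G : Finset M → ℝ) {D B A : Finset M} (hDB : D ⊆ B) (hBA : B ⊆ A) :
    m.value G D A =
      subsetExp Finset.univ (fun v => 1 - m.fail v D B) fun S => m.value G B (A ∪ S) := by
  induction hk : Dᶜ.card using Nat.strong_induction_on generalizing D B A with
  | _ k ih =>
    subst hk
    rcases eq_or_ne D A with rfl | hne
    · obtain rfl : D = B := hDB.antisymm hBA
      exact m.value_eq G hDB
    · have hDA := hDB.trans hBA
      have hlt := card_compl_lt_of_ssubset (hDA.ssubset_of_ne hne)
      rw [m.value_eq G hDA, m.subsetExp_fail_union _ hDB hBA]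
      congr 1
      funext S
      have hS : A ⊆ A ∪ S := Finset.subset_union_left
      rw [m.value_eq G (hBA.trans hS), m.subsetExp_fail_union _ hBA hS]
      congr 1
      funext S'
      rw [ih _ hlt hS (Finset.union_subset_union_right Finset.subset_union_left) rfl]
      simp only [Finset.union_assoc]

/-- The nodes of `W` may wait until the cascade of the other nodes has terminated. -/
theorem value_union (G : Finset M → ℝ) (W : Finset M) {D A : Finset M} (hDA : D ⊆ A) :
    m.value G D (A ∪ W) = m.value (fun T => m.value G T (T ∪ W)) D A := by
  induction hk : Dᶜ.card using Nat.strong_induction_on generalizing D A with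
  | _ k ih =>
    subst hk
    rcases eq_or_ne D A with rfl | hne
    · rw [m.value_self]
    · have hlt := card_compl_lt_of_ssubset (hDA.ssubset_of_ne hne)
      rw [m.value_eq_of_subset G hDA Finset.subset_union_left, m.value_eq _ hDA]
      congr 1
      funext S
      rw [← ih _ hlt Finset.subset_union_left rfl, Finset.union_right_comm]

/-- The final set contains the nodes that are active now. -/
theorem le_value {G : Finset M → ℝ} {c : ℝ} {D A : Finset M} (hDA : D ⊆ A)
    (h : ∀ T, A ⊆ T → c ≤ G T) : c ≤ m.value G D A := by
  induction hk : Dᶜ.card using Nat.strong_induction_on generalizing D A with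
  | _ k ih =>
    subst hk
    rcases eq_or_ne D A with rfl | hne
    · rw [m.value_self]; exact h D subset_rfl
    · have hlt := card_compl_lt_of_ssubset (hDA.ssubset_of_ne hne)
      rw [m.value_eq G hDA,
        ← subsetExp_const Finset.univ (fun v => 1 - m.fail v D A) c]
      exact subsetExp_mono (fun v => m.one_sub_fail_nonneg v D A)
        (fun v => m.one_sub_fail_le_one v D A) fun S =>
        ih _ hlt Finset.subset_union_left
          (fun T hT => h T (Finset.subset_union_left.trans hT)) rfl

theorem value_le {G : Finset M → ℝ} {c : ℝ} {D A : Finset M} (hDA : D ⊆ A)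
    (h : ∀ T, A ⊆ T → G T ≤ c) : m.value G D A ≤ c := by
  induction hk : Dᶜ.card using Nat.strong_induction_on generalizing D A with
  | _ k ih =>
    subst hk
    rcases eq_or_ne D A with rfl | hne
    · rw [m.value_self]; exact h D subset_rfl
    · have hlt := card_compl_lt_of_ssubset (hDA.ssubset_of_ne hne)
      rw [m.value_eq G hDA,
        ← subsetExp_const Finset.univ (fun v => 1 - m.fail v D A) c]
      exact subsetExp_mono (fun v => m.one_sub_fail_nonneg v D A)
        (fun v => m.one_sub_fail_le_one v D A) fun S =>
        ih _ hlt Finset.subset_union_left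
          (fun T hT => h T (Finset.subset_union_left.trans hT)) rfl

theorem expAfter_mono {G G' : Finset M → ℝ} (h : ∀ T, G T ≤ G' T) (n : ℕ) (D A : Finset M) :
    expAfter m.fail G n D A ≤ expAfter m.fail G' n D A := by
  induction n generalizing D A with
  | zero => exact h A
  | succ n ih =>
    exact subsetExp_mono (fun v => m.one_sub_fail_nonneg v D A)
      (fun v => m.one_sub_fail_le_one v D A) fun S => ih _ _

theorem expAfter_sub (G G' : Finset M → ℝ) (n : ℕ) (D A : Finset M) :
    expAfter m.fail (fun T => G T - G' T) n D A =
      expAfter m.fail G n D A - expAfter m.fail G' n D A := by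
  induction n generalizing D A with
  | zero => rfl
  | succ n ih => simp only [expAfter, ih, subsetExp_sub]

/-- The gain of weight from the attempts of the nodes of `A \ D` is smaller when more nodes have
attempted before, and fewer are waiting to attempt. The two cascades are coupled: the nodes waiting
in the second one attempt first in both of them, with smaller success probabilities in the second,
so that the nodes activated in the second cascade are, in the first one, activated, too, or waiting
already. -/
theorem value_sub_le_value_sub {w : M → ℝ} (hw : ∀ v, 0 ≤ w v) {D A D' A' : Finset M}
    (hDA : D ⊆ A) (hDA' : D' ⊆ A') (hD : D ⊆ D') (hA : A' \ D' ⊆ A \ D) :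
    m.value (fun T => ∑ v ∈ T, w v) D' A' - ∑ v ∈ D', w v ≤
      m.value (fun T => ∑ v ∈ T, w v) D A - ∑ v ∈ D, w v := by
  induction hk : D'ᶜ.card using Nat.strong_induction_on generalizing D A D' A' with
  | _ k ih =>
    subst hk
    rcases eq_or_ne D' A' with rfl | hne
    · rw [m.value_self, sub_self, sub_nonneg]
      exact m.le_value hDA fun T hT =>
        Finset.sum_le_sum_of_subset_of_nonneg (hDA.trans hT) fun v _ _ => hw v
    · have hlt := card_compl_lt_of_ssubset (hDA'.ssubset_of_ne hne)
      obtain ⟨X, hX⟩ : ∃ X, X = A' \ D' := ⟨_, rfl⟩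
      have hA' : A' = D' ∪ X := by rw [hX, Finset.union_sdiff_of_subset hDA']
      have hXD' : Disjoint X D' := hX ▸ Finset.sdiff_disjoint
      have hXD : Disjoint X D := hXD'.mono_right hD
      rw [← hX] at hA
      have hXA : D ∪ X ⊆ A := Finset.union_subset hDA (hA.trans Finset.sdiff_subset)
      rw [m.value_eq _ hDA', m.value_eq_of_subset _ Finset.subset_union_left hXA]
      have e' : ∑ v ∈ D', w v = ∑ v ∈ A', w v - ∑ v ∈ X, w v := by
        rw [hA', Finset.sum_union hXD'.symm]; ring
      have e : ∑ v ∈ D, w v = ∑ v ∈ D ∪ X, w v - ∑ v ∈ X, w v := by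
        rw [Finset.sum_union hXD.symm]; ring
      rw [e, e', ← sub_add, ← sub_add, add_le_add_iff_right,
        ← subsetExp_const Finset.univ (fun v => 1 - m.fail v D' A') (∑ v ∈ A', w v),
        ← subsetExp_const Finset.univ (fun v => 1 - m.fail v D (D ∪ X)) (∑ v ∈ D ∪ X, w v),
        ← subsetExp_sub, ← subsetExp_sub]
      refine subsetExp_le_subsetExp (fun v => m.one_sub_fail_nonneg _ _ _) (fun v => ?_)
        (fun v => m.one_sub_fail_le_one _ _ _) fun S S' hSS' => ?_
      · rw [hA']
        exact sub_le_sub_left (m.fail_mono v hD hXD') 1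
      · refine ih _ hlt (hXA.trans Finset.subset_union_left) Finset.subset_union_left
          (hA' ▸ Finset.union_subset_union_left hD) (fun v hv => ?_) rfl
        have h1 := @hSS' v
        have h2 := @hD v
        simp only [hA', Finset.mem_sdiff, Finset.mem_union] at hv ⊢
        tauto

/-- Kempe, Kleinberg and Tardos: in an order independent decreasing cascade, the expected weight of
the final set of active nodes is a submodular function of the initial set. -/
theorem value_union_sub_le {w : M → ℝ} (hw : ∀ v, 0 ≤ w v) {A A' : Finset M} (W : Finset M)
    (h : A ⊆ A') :
    m.value (fun T => ∑ v ∈ T, w v) ∅ (A' ∪ W) - m.value (fun T => ∑ v ∈ T, w v) ∅ A' ≤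
      m.value (fun T => ∑ v ∈ T, w v) ∅ (A ∪ W) - m.value (fun T => ∑ v ∈ T, w v) ∅ A := by
  set w' : Finset M → ℝ := fun T => ∑ v ∈ T, w v with hw'
  set gain : Finset M → ℝ := fun T => m.value w' T (T ∪ W) - w' T with hgain
  have key : ∀ B, m.value w' ∅ (B ∪ W) - m.value w' ∅ B = m.value gain ∅ B := fun B => by
    rw [m.value_union w' W (Finset.empty_subset B)]
    exact (m.expAfter_sub _ _ _ _ _).symm
  have hanti : ∀ T T', T ⊆ T' → gain T' ≤ gain T := fun T T' hT =>
    m.value_sub_le_value_sub hw Finset.subset_union_left Finset.subset_union_left hT fun v hv => by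
      have := @hT v
      simp only [Finset.mem_sdiff, Finset.mem_union] at hv ⊢
      tauto
  rw [key, key, ← Finset.union_eq_right.2 h, m.value_union gain A' (Finset.empty_subset A)]
  exact m.expAfter_mono (fun T => m.value_le Finset.subset_union_left fun T' hT' =>
    hanti T T' (Finset.subset_union_left.trans hT')) _ _ _

end FailureModel

end Value

/-! ### Failure probabilities on a graph -/

section Graph

variable {N : Type*} [Fintype N] [DecidableEq N]

theorem mem_inNbrs {N : Type*} [Fintype N] {G : Digraph N} {u v : N} :
    u ∈ inNbrs G v ↔ G.Adj u v := by
  simp [inNbrs]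

theorem failProb_append {N : Type*} [DecidableEq N] (p : SuccessProb N) (v : N) (S : Finset N)
    (l l' : List N) :
    failProb p v S (l ++ l') = failProb p v S l * failProb p v (S ∪ l.toFinset) l' := by
  induction l generalizing S with
  | nil => simp [failProb]
  | cons u l ih =>
    rw [List.cons_append, failProb, failProb, ih, mul_assoc, List.toFinset_cons,
      Finset.union_insert, Finset.insert_union]

/-- In a decreasing cascade, earlier attempts by further nodes make failure more likely. -/
theorem failProb_mono {G : Digraph N} {p : SuccessProb N} (hd : Decreasing G p) {v : N}
    {S S' : Finset N} {l : List N} (hS : S ⊆ S') (hS' : S' ⊆ inNbrs G v) (hl : l.Nodup)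
    (hlG : ∀ u ∈ l, u ∈ inNbrs G v ∧ u ∉ S') :
    (failProb p v S l : ℝ) ≤ failProb p v S' l := by
  induction l generalizing S S' with
  | nil => exact le_rfl
  | cons u l ih =>
    obtain ⟨hu, huS⟩ := hlG u List.mem_cons_self
    rw [List.nodup_cons] at hl
    have h1 : ((σ (p v u S) : I) : ℝ) ≤ σ (p v u S') :=
      unitInterval.symm_le_symm.2 (hd v u S S' hS hS' hu huS)
    have h2 := ih (Finset.insert_subset_insert u hS) (Finset.insert_subset hu hS') hl.2
      fun x hx => ⟨(hlG x (List.mem_cons_of_mem u hx)).1, fun h => by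
        rcases Finset.mem_insert.1 h with rfl | h
        · exact hl.1 hx
        · exact (hlG x (List.mem_cons_of_mem u hx)).2 h⟩
    exact mul_le_mul h1 h2 (failProb p v _ l).2.1 (σ (p v u S')).2.1

/-- The probability that the attempts on `x` by its neighbours in `A \ D` all fail, given that
those in `D` have attempted before. The attempts are made in an arbitrary order. -/
noncomputable def graphFail (G : Digraph N) (p : SuccessProb N) (x : N) (D A : Finset N) : ℝ :=
  failProb p x (D ∩ inNbrs G x) ((A ∩ inNbrs G x) \ (D ∩ inNbrs G x)).toList

theorem graphFail_self (G : Digraph N) (p : SuccessProb N) (x : N) (D : Finset N) :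
    graphFail G p x D D = 1 := by
  simp [graphFail, failProb]

theorem failProb_eq_of_toFinset_eq {G : Digraph N} {p : SuccessProb N}
    (hi : OrderIndependent G p) {v : N} {S : Finset N} {l l' : List N} (hS : S ⊆ inNbrs G v)
    (hl : l.Nodup) (hl' : l'.Nodup) (h : l.toFinset = l'.toFinset)
    (hlG : ∀ u ∈ l, u ∈ inNbrs G v ∧ u ∉ S) : failProb p v S l = failProb p v S l' :=
  hi v S l l' hS hl hlG (List.perm_of_nodup_nodup_toFinset_eq hl hl' h)

/-- An order independent decreasing cascade on a graph, as a `FailureModel`. -/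
noncomputable def graphModel (G : Digraph N) (p : SuccessProb N) (hi : OrderIndependent G p)
    (hd : Decreasing G p) : FailureModel N where
  fail := graphFail G p
  fail_nonneg v D A := (failProb p v _ _).2.1
  fail_le_one v D A := (failProb p v _ _).2.2
  fail_self := graphFail_self G p
  fail_mul v {D B A} h h' := by
    have hS : D ∩ inNbrs G v ⊆ B ∩ inNbrs G v := Finset.inter_subset_inter_right h
    have hS' : B ∩ inNbrs G v ⊆ A ∩ inNbrs G v := Finset.inter_subset_inter_right h'
    have hK : A ∩ inNbrs G v ⊆ inNbrs G v := Finset.inter_subset_right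
    unfold graphFail
    generalize D ∩ inNbrs G v = D at *
    generalize B ∩ inNbrs G v = B at *
    generalize A ∩ inNbrs G v = A at *
    have := failProb_append p v D (B \ D).toList (A \ B).toList
    rw [Finset.toList_toFinset, Finset.union_sdiff_of_subset hS] at this
    rw [← Set.Icc.coe_mul, ← this]
    refine congrArg _ (failProb_eq_of_toFinset_eq hi (hS.trans (hS'.trans hK)) ?_
      (Finset.nodup_toList _) ?_ ?_)
    · refine List.Nodup.append (Finset.nodup_toList _) (Finset.nodup_toList _) ?_
      intro x hx hx'
      simp only [Finset.mem_toList, Finset.mem_sdiff] at hx hx'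
      exact hx'.2 hx.1
    · ext x
      have h1 := @hS x
      have h2 := @hS' x
      simp only [List.toFinset_append, Finset.toList_toFinset, Finset.mem_union, Finset.mem_sdiff]
      tauto
    · intro x hx
      have h1 := @hS x
      have h2 := @hS' x
      have h3 := @hK x
      simp only [List.mem_append, Finset.mem_toList, Finset.mem_sdiff] at hx
      tauto
  fail_mono v {D D' X} h h' := by
    have e : ∀ S : Finset N, S ⊆ D' →
        ((S ∪ X) ∩ inNbrs G v) \ (S ∩ inNbrs G v) = X ∩ inNbrs G v := fun S hS => by
      ext x
      have h1 := @hS x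
      have h2 : x ∈ X → x ∉ D' := fun hx => Finset.disjoint_left.1 h' hx
      simp only [Finset.mem_sdiff, Finset.mem_inter, Finset.mem_union]
      tauto
    rw [graphFail, graphFail, e D h, e D' subset_rfl]
    refine failProb_mono hd (Finset.inter_subset_inter_right h) Finset.inter_subset_right
      (Finset.nodup_toList _) fun u hu => ?_
    simp only [Finset.mem_toList, Finset.mem_inter] at hu ⊢
    exact ⟨hu.2, fun h2 => Finset.disjoint_left.1 h' hu.1 h2.1⟩

end Graph

/-! ### The arcs of the source as seed nodes -/

section Split

variable {N : Type*} [Fintype N] [DecidableEq N]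

/-- The nodes whose attempts on `x` are recorded by `D`. In `N ⊕ N` the node `inl x` acts as a copy
of `s` that has an arc to `x` only, and `inr s` makes no attempts. -/
def exposures (s x : N) (D : Finset (N ⊕ N)) : Finset N :=
  Finset.univ.filter fun y => (if y = s then Sum.inl x else Sum.inr y) ∈ D

theorem mem_exposures {s x y : N} {D : Finset (N ⊕ N)} :
    y ∈ exposures s x D ↔ (if y = s then Sum.inl x else Sum.inr y) ∈ D := by
  simp [exposures]

theorem exposures_mono (s x : N) {D D' : Finset (N ⊕ N)} (h : D ⊆ D') :
    exposures s x D ⊆ exposures s x D' := fun _ hy => mem_exposures.2 (h (mem_exposures.1 hy))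

/-- The cascade in which the source `s` is split into separate nodes, one for each possible target,
none of which is ever activated by other nodes. -/
def FailureModel.splitSource (m : FailureModel N) (s : N) : FailureModel (N ⊕ N) where
  fail
    | .inl _, _, _ => 1
    | .inr x, D, A => m.fail x (exposures s x D) (exposures s x A)
  fail_nonneg
    | .inl _, _, _ => zero_le_one
    | .inr x, _, _ => m.fail_nonneg x _ _
  fail_le_one
    | .inl _, _, _ => le_rfl
    | .inr x, _, _ => m.fail_le_one x _ _
  fail_self
    | .inl _, _ => rfl
    | .inr x, _ => m.fail_self x _
  fail_mul v {_ _ _} h h' := by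
    rcases v with x | x
    · exact mul_one 1
    · exact m.fail_mul x (exposures_mono s x h) (exposures_mono s x h')
  fail_mono v {D D' X} h h' := by
    rcases v with x | x
    · exact le_rfl
    · have e : ∀ S : Finset (N ⊕ N),
          exposures s x (S ∪ X) = exposures s x S ∪ exposures s x X := fun S => by
        ext y; simp only [Finset.mem_union, mem_exposures]
      simp only [e]
      refine m.fail_mono x (exposures_mono s x h) (Finset.disjoint_left.2 fun y hy hy' => ?_)
      exact Finset.disjoint_left.1 h' (mem_exposures.1 hy) (mem_exposures.1 hy')

open Classical in
/-- The copies of the source `s` that correspond to the arcs of `G` from `s`. -/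
noncomputable def sourceCopies (G : Digraph N) (s : N) : Finset (N ⊕ N) :=
  (Finset.univ.filter fun x => G.Adj s x).map Function.Embedding.inl

theorem mem_sourceCopies {N : Type*} [Fintype N] {G : Digraph N} {s : N} {y : N ⊕ N} :
    y ∈ sourceCopies G s ↔ ∃ x, G.Adj s x ∧ Sum.inl x = y := by
  simp [sourceCopies]

theorem sourceCopies_mono {N : Type*} [Fintype N] {G G' : Digraph N} {s : N}
    (h : ∀ x, G.Adj s x → G'.Adj s x) : sourceCopies G s ⊆ sourceCopies G' s := fun _ hy => by
  obtain ⟨x, hx, rfl⟩ := mem_sourceCopies.1 hy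
  exact mem_sourceCopies.2 ⟨x, h x hx, rfl⟩

/-- The set of nodes of the split cascade that corresponds to a set `S` of nodes of `G`: if `S`
contains the source, its copies are included along with the inert node `inr s`. -/
noncomputable def splitSet (G : Digraph N) (s : N) (S : Finset N) : Finset (N ⊕ N) :=
  (if s ∈ S then sourceCopies G s else ∅) ∪ S.map Function.Embedding.inr

theorem inl_mem_splitSet {G : Digraph N} {s x : N} {S : Finset N} :
    Sum.inl x ∈ splitSet G s S ↔ s ∈ S ∧ G.Adj s x := by
  by_cases h : s ∈ S <;> simp [splitSet, h, mem_sourceCopies]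

theorem inr_mem_splitSet {G : Digraph N} {s x : N} {S : Finset N} :
    Sum.inr x ∈ splitSet G s S ↔ x ∈ S := by
  by_cases h : s ∈ S <;> simp [splitSet, h, mem_sourceCopies]

theorem splitSet_union {G : Digraph N} {s : N} {A : Finset N} (hs : s ∈ A) (S : Finset N) :
    splitSet G s (A ∪ S) = splitSet G s A ∪ S.map Function.Embedding.inr := by
  rw [splitSet, splitSet, if_pos hs, if_pos (Finset.mem_union_left _ hs), Finset.map_union,
    Finset.union_assoc]

theorem sum_splitSet (G : Digraph N) (s : N) (S : Finset N) (w : N → ℝ) :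
    ∑ y ∈ splitSet G s S, Sum.elim (fun _ => 0) w y = ∑ x ∈ S, w x := by
  have hd : Disjoint (if s ∈ S then sourceCopies G s else ∅) (S.map Function.Embedding.inr) := by
    rw [Finset.disjoint_left]
    intro y hy hy'
    obtain ⟨x, -, rfl⟩ := Finset.mem_map.1 hy'
    split_ifs at hy
    · simp [mem_sourceCopies] at hy
    · simp at hy
  rw [splitSet, Finset.sum_union hd, Finset.sum_map, Finset.sum_eq_zero, zero_add]
  · rfl
  · intro y hy
    split_ifs at hy
    · obtain ⟨x, -, rfl⟩ := mem_sourceCopies.1 hy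
      rfl
    · simp at hy

/-- A subgraph `G'` of `G` that lacks only arcs from `s` has the failure probabilities of the split
cascade of `G`. -/
theorem graphFail_eq_splitSource {G G' : Digraph N} {p : SuccessProb N}
    (hi : OrderIndependent G p) (hd : Decreasing G p) {s : N}
    (hG : ∀ y x, G'.Adj y x → G.Adj y x) (hG' : ∀ y x, y ≠ s → G.Adj y x → G'.Adj y x)
    (x : N) (D A : Finset N) :
    graphFail G' p x D A = ((graphModel G p hi hd).splitSource s).fail (.inr x)
      (splitSet G' s D) (splitSet G' s A) := by
  have e : ∀ S, exposures s x (splitSet G' s S) ∩ inNbrs G x = S ∩ inNbrs G' x := fun S => by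
    ext y
    rw [Finset.mem_inter, Finset.mem_inter, mem_exposures, mem_inNbrs, mem_inNbrs]
    by_cases hy : y = s
    · subst hy
      rw [if_pos rfl, inl_mem_splitSet, and_iff_left_of_imp fun h => hG y x h.2]
    · rw [if_neg hy, inr_mem_splitSet]
      exact and_congr_right fun _ => ⟨hG' y x hy, hG y x⟩
  change _ = graphFail G p x _ _
  rw [graphFail, graphFail, e, e]

theorem expAfter_graphFail_eq_splitSource {G G' : Digraph N} {p : SuccessProb N}
    (hi : OrderIndependent G p) (hd : Decreasing G p) {s : N}
    (hG : ∀ y x, G'.Adj y x → G.Adj y x) (hG' : ∀ y x, y ≠ s → G.Adj y x → G'.Adj y x)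
    (w : N → ℝ) (n : ℕ) (D : Finset N) {A : Finset N} (hs : s ∈ A) :
    expAfter (graphFail G' p) (fun T => ∑ x ∈ T, w x) n D A =
      expAfter ((graphModel G p hi hd).splitSource s).fail
        (fun T => ∑ y ∈ T, Sum.elim (fun _ => 0) w y) n (splitSet G' s D) (splitSet G' s A) := by
  induction n generalizing D A with
  | zero => exact (sum_splitSet G' s A w).symm
  | succ n ih =>
    have hu : (Finset.univ : Finset (N ⊕ N)) =
        Finset.univ.map Function.Embedding.inl ∪ Finset.univ.map Function.Embedding.inr := by
      ext y; cases y <;> simp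
    rw [expAfter, expAfter, hu, subsetExp_union_of_eq_zero, subsetExp_map]
    · simp only [← splitSet_union hs]
      rw [subsetExp_congr_prob (q' := (fun v => 1 - ((graphModel G p hi hd).splitSource s).fail v
        (splitSet G' s D) (splitSet G' s A)) ∘ Function.Embedding.inr) fun x _ => ?_]
      · congr 1
        funext S
        exact ih A (Finset.mem_union_left S hs)
      · rw [graphFail_eq_splitSource hi hd hG hG']
        rfl
    · intro y hy
      obtain ⟨x, -, rfl⟩ := Finset.mem_map.1 hy
      exact sub_self (1 : ℝ)

end Split

/-! ### The law of the cascade -/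

section Law

/-- The expectation of `f` under a probability mass function on a finite type. -/
noncomputable def pmfExp {α : Type*} [Fintype α] (μ : PMF α) (f : α → ℝ) : ℝ :=
  ∑ a, (μ a).toReal * f a

theorem pmfExp_pure {α : Type*} [Fintype α] (a : α) (f : α → ℝ) :
    pmfExp (PMF.pure a) f = f a := by
  classical
  rw [pmfExp, Finset.sum_eq_single a]
  · simp
  · intro b _ hb
    simp [PMF.pure_apply, hb]
  · simp

theorem pmfExp_bind {α β : Type*} [Fintype α] [Fintype β] (μ : PMF α) (κ : α → PMF β)
    (f : β → ℝ) : pmfExp (μ.bind κ) f = pmfExp μ fun a => pmfExp (κ a) f := by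
  simp only [pmfExp, PMF.bind_apply, tsum_fintype, Finset.mul_sum]
  rw [Finset.sum_comm]
  refine Finset.sum_congr rfl fun b _ => ?_
  rw [ENNReal.toReal_sum fun a _ => ENNReal.mul_ne_top (μ.apply_ne_top a) ((κ a).apply_ne_top b),
    Finset.sum_mul]
  exact Finset.sum_congr rfl fun a _ => by rw [ENNReal.toReal_mul, mul_assoc]

theorem pmfExp_map {α β : Type*} [Fintype α] [Fintype β] (μ : PMF α) (g : α → β) (f : β → ℝ) :
    pmfExp (μ.map g) f = pmfExp μ fun a => f (g a) := by
  rw [← PMF.bind_pure_comp, pmfExp_bind]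
  simp only [Function.comp, pmfExp_pure]

theorem pmfExp_congr {α : Type*} [Fintype α] {μ : PMF α} {f g : α → ℝ}
    (h : ∀ a ∈ μ.support, f a = g a) : pmfExp μ f = pmfExp μ g := by
  refine Finset.sum_congr rfl fun a _ => ?_
  by_cases ha : a ∈ μ.support
  · rw [h a ha]
  · rw [PMF.mem_support_iff, not_not] at ha
    simp [ha]

variable {N : Type*} [Fintype N] [DecidableEq N]

theorem pmfExp_bernoulliSubset (s : Finset N) (q : N → I) (F : Finset N → ℝ) :
    pmfExp (bernoulliSubset s q) F = subsetExp s (fun v => q v) F := by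
  rw [pmfExp, subsetExp, ← Finset.sum_subset (Finset.subset_univ s.powerset)]
  · refine Finset.sum_congr rfl fun S hS => ?_
    rw [bernoulliSubset, PMF.ofFinset_apply, bernoulliWeight, if_pos (Finset.mem_powerset.1 hS),
      ENNReal.toReal_mul, ENNReal.toReal_prod, ENNReal.toReal_prod]
    rfl
  · intro S _ hS
    rw [bernoulliSubset, PMF.ofFinset_apply, bernoulliWeight,
      if_neg fun h => hS (Finset.mem_powerset.2 h), ENNReal.toReal_zero, zero_mul]

variable {G₀ G : Digraph N} {p : SuccessProb N} (o : AttemptOrder N)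

/-- The probabilities of a step do not depend on the order of the attempts, as soon as `p` is order
independent on a graph that contains `G`. -/
theorem activationProb_eq (hi : OrderIndependent G₀ p) (hG : ∀ y x, G.Adj y x → G₀.Adj y x)
    {A C : Finset N} (hC : C ⊆ A) (v : N) :
    (activationProb G p o A C v : ℝ) = 1 - graphFail G p v (A \ C) A := by
  have hK : inNbrs G v ⊆ inNbrs G₀ v := fun y hy => mem_inNbrs.2 (hG y v (mem_inNbrs.1 hy))
  rw [activationProb, unitInterval.coe_symm_eq, graphFail, Finset.inter_comm]
  congr 2
  refine failProb_eq_of_toFinset_eq hi (Finset.inter_subset_right.trans hK)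
    ((o.nodup v A C).filter _) (Finset.nodup_toList _) ?_ fun u hu => ?_
  · ext u
    have := @hC u
    simp only [List.mem_toFinset, List.mem_filter, o.mem_iff, decide_eq_true_eq,
      Finset.toList_toFinset, Finset.mem_sdiff, Finset.mem_inter]
    tauto
  · simp only [List.mem_filter, o.mem_iff, decide_eq_true_eq] at hu
    simp only [Finset.mem_inter, Finset.mem_sdiff]
    exact ⟨hK hu.2, fun h => h.1.2 hu.1⟩

theorem pmfExp_step (hi : OrderIndependent G₀ p) (hG : ∀ y x, G.Adj y x → G₀.Adj y x)
    (F : Finset N → ℝ) (n : ℕ) {A C : Finset N} (hC : C ⊆ A) :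
    pmfExp (step G p o (A, C)) (fun s => expAfter (graphFail G p) F n (s.1 \ s.2) s.1) =
      expAfter (graphFail G p) F (n + 1) (A \ C) A := by
  rw [step, pmfExp_map, pmfExp_bernoulliSubset, expAfter, ← subsetExp_sdiff Finset.univ A _
    fun S => expAfter (graphFail G p) F n A S, ← Finset.compl_eq_univ_sdiff,
    subsetExp_congr_prob fun v _ => activationProb_eq o hi hG hC v]
  refine Finset.sum_congr rfl fun S hS => ?_
  have hd : Disjoint A S :=
    Finset.disjoint_left.2 fun x hx hxS => Finset.mem_compl.1 (Finset.mem_powerset.1 hS hxS) hx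
  simp only [Finset.union_sdiff_cancel_right hd]

theorem snd_subset_fst_of_mem_support_stateLaw {A : Finset N} {t : ℕ} {s : Finset N × Finset N}
    (hs : s ∈ (stateLaw G p o A t).support) : s.2 ⊆ s.1 := by
  cases t with
  | zero =>
    rw [stateLaw, PMF.mem_support_pure_iff] at hs
    rw [hs]
  | succ t =>
    rw [stateLaw, PMF.mem_support_bind_iff] at hs
    obtain ⟨s', -, hs⟩ := hs
    rw [step, PMF.mem_support_map_iff] at hs
    obtain ⟨D, -, rfl⟩ := hs
    exact Finset.subset_union_right

/-- The expectation of `F` after `n` steps from the random state at time `t`, found by running the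
last of the `t` steps backwards, then the one before it, and so on. -/
theorem pmfExp_stateLaw (hi : OrderIndependent G₀ p) (hG : ∀ y x, G.Adj y x → G₀.Adj y x)
    (F : Finset N → ℝ) (A : Finset N) (t n : ℕ) :
    pmfExp (stateLaw G p o A t) (fun s => expAfter (graphFail G p) F n (s.1 \ s.2) s.1) =
      expAfter (graphFail G p) F (n + t) ∅ A := by
  induction t generalizing n with
  | zero => rw [stateLaw, pmfExp_pure, Finset.sdiff_self, add_zero]
  | succ t ih =>
    rw [stateLaw, pmfExp_bind, pmfExp_congr fun s hs => pmfExp_step o hi hG F n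
      (snd_subset_fst_of_mem_support_stateLaw o hs), ih, add_assoc, add_comm 1 t]

theorem pmfExp_finalLaw (hi : OrderIndependent G₀ p) (hG : ∀ y x, G.Adj y x → G₀.Adj y x)
    (F : Finset N → ℝ) (A : Finset N) :
    pmfExp (finalLaw G p o A) F = expAfter (graphFail G p) F (Fintype.card N) ∅ A := by
  rw [finalLaw, pmfExp_map]
  have h := pmfExp_stateLaw o hi hG F A (Fintype.card N) 0
  rwa [zero_add] at h

/-- The expected weight of the final set of active nodes, for a subgraph that lacks only arcs from
the source `s`: the copies of `s` that belong to the remaining arcs are seeds of the split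
cascade. -/
theorem pmfExp_finalLaw_eq_value (hi : OrderIndependent G₀ p) (hd : Decreasing G₀ p) {s : N}
    (hG : ∀ y x, G.Adj y x → G₀.Adj y x) (hG' : ∀ y x, y ≠ s → G₀.Adj y x → G.Adj y x)
    (w : N → ℝ) :
    pmfExp (finalLaw G p o {s}) (fun T => ∑ x ∈ T, w x) =
      ((graphModel G₀ p hi hd).splitSource s).value
        (fun T => ∑ y ∈ T, Sum.elim (fun _ => 0) w y) ∅ (sourceCopies G s ∪ {.inr s}) := by
  have hcard : Fintype.card N ≤ Fintype.card (N ⊕ N) := by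
    rw [Fintype.card_sum]; exact Nat.le_add_left _ _
  rw [pmfExp_finalLaw o hi hG, ← expAfter_eq_of_le (graphFail_self G p) _ (Finset.empty_subset _)
    (Finset.card_le_univ _) hcard, expAfter_graphFail_eq_splitSource hi hd hG hG' w _ _
    (Finset.mem_singleton_self s)]
  simp [splitSet, FailureModel.value]

end Law

/-! ### Readers and followers -/

section Readers

variable {V : Type*}

theorem doubledGraph_adj_inl {G : Digraph (Option V)} {t v : Option V} :
    (doubledGraph G).Adj (.inl t) (.inl v) ↔ G.Adj t v := Iff.rfl

theorem exists_inl_of_mem_inNbrs [Fintype V] {G : Digraph (Option V)} {x y : Option V ⊕ V}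
    (h : y ∈ inNbrs (doubledGraph G) x) : ∃ t, y = .inl t := by
  rcases y with t | u
  · exact ⟨t, rfl⟩
  · exact (mem_inNbrs.1 h).elim

theorem toLeft_subset_inNbrs [Fintype V] [DecidableEq V] {G : Digraph (Option V)} {v : Option V}
    {S : Finset (Option V ⊕ V)} (hS : S ⊆ inNbrs (doubledGraph G) (.inl v)) :
    S.toLeft ⊆ inNbrs G v := fun _ ht =>
  mem_inNbrs.2 (doubledGraph_adj_inl.1 (mem_inNbrs.1 (hS (Finset.mem_toLeft.1 ht))))

theorem failProb_doubledProb_inl [DecidableEq V] (p : SuccessProb (Option V)) (v : Option V)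
    (S : Finset (Option V ⊕ V)) (l : List (Option V)) :
    failProb (doubledProb p) (.inl v) S (l.map .inl) = failProb p v S.toLeft l := by
  induction l generalizing S with
  | nil => rfl
  | cons u l ih =>
    rw [List.map_cons, failProb, failProb, ih, Finset.toLeft_insert_inl]
    rfl

theorem failProb_doubledProb_inr [DecidableEq V] (p : SuccessProb (Option V)) (u : V)
    (S : Finset (Option V ⊕ V)) (l : List (Option V ⊕ V)) :
    failProb (doubledProb p) (.inr u) S l = if l = [] then 1 else 0 := by
  cases l with
  | nil => rfl
  | cons y l =>
    rw [failProb, if_neg (List.cons_ne_nil y l)]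
    change σ 1 * _ = _
    rw [unitInterval.symm_one, zero_mul]

/-- Attempts on a retweeter come from retweeters, as in the original graph, and the first attempt on
a reader succeeds. -/
theorem orderIndependent_doubled [Fintype V] [DecidableEq V] {G : Digraph (Option V)}
    {p : SuccessProb (Option V)} (h : OrderIndependent G p) :
    OrderIndependent (doubledGraph G) (doubledProb p) := by
  rintro (v | u) S l l' hS hl hlG hp
  · have hex : ∀ l : List (Option V ⊕ V), (∀ y ∈ l, ∃ t, y = .inl t) →
        ∃ k : List (Option V), k.map .inl = l := fun l hl => by
      induction l with
      | nil => exact ⟨[], rfl⟩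
      | cons y l ih =>
        obtain ⟨k, rfl⟩ := ih fun y hy => hl y (List.mem_cons_of_mem _ hy)
        obtain ⟨t, rfl⟩ := hl y List.mem_cons_self
        exact ⟨t :: k, rfl⟩
    obtain ⟨k, rfl⟩ := hex l fun y hy => exists_inl_of_mem_inNbrs (hlG y hy).1
    obtain ⟨k', rfl⟩ := hex l' fun y hy => exists_inl_of_mem_inNbrs (hlG y (hp.mem_iff.2 hy)).1
    rw [failProb_doubledProb_inl, failProb_doubledProb_inl]
    refine h v S.toLeft k k' (toLeft_subset_inNbrs hS) (List.Nodup.of_map _ hl) (fun t ht => ?_)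
      ((List.map_perm_map_iff Sum.inl_injective).1 hp)
    obtain ⟨h1, h2⟩ := hlG (.inl t) (List.mem_map_of_mem ht)
    exact ⟨mem_inNbrs.2 (doubledGraph_adj_inl.1 (mem_inNbrs.1 h1)),
      fun h3 => h2 (Finset.mem_toLeft.1 h3)⟩
  · rw [failProb_doubledProb_inr, failProb_doubledProb_inr]
    exact if_congr ⟨fun e => (e ▸ hp).nil_eq.symm, fun e => (e ▸ hp).eq_nil⟩ rfl rfl

theorem decreasing_doubled [Fintype V] [DecidableEq V] {G : Digraph (Option V)}
    {p : SuccessProb (Option V)} (h : Decreasing G p) :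
    Decreasing (doubledGraph G) (doubledProb p) := by
  rintro (v | w) u S T hST hT hu huT
  · obtain ⟨t, rfl⟩ := exists_inl_of_mem_inNbrs hu
    exact h v t S.toLeft T.toLeft (Finset.toLeft_subset_toLeft hST) (toLeft_subset_inNbrs hT)
      (mem_inNbrs.2 (doubledGraph_adj_inl.1 (mem_inNbrs.1 hu)))
      fun h' => huT (Finset.mem_toLeft.1 h')
  · exact le_rfl

theorem doubledGraph_mono {G G' : Digraph (Option V)} (h : ∀ t v, G.Adj t v → G'.Adj t v) :
    ∀ y x, (doubledGraph G).Adj y x → (doubledGraph G').Adj y x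
  | .inl t, .inl v, h' => h t v h'
  | .inl t, .inr u, h' => Or.imp_right (h t (some u)) h'

theorem withSource_mono (E : Digraph V) {R R' : Finset V} (h : R ⊆ R') :
    ∀ t v, (withSource E R).Adj t v → (withSource E R').Adj t v
  | some _, some _, h' => h'
  | none, some _, h' => h h'

/-- The users who follow `u₀` back determine the arcs from `u₀` only. -/
theorem doubledGraph_withSource_adj (E : Digraph V) (R R' : Finset V) :
    ∀ y x, y ≠ .inl none → (doubledGraph (withSource E R)).Adj y x →
      (doubledGraph (withSource E R')).Adj y x
  | .inl none, _, hy, _ => (hy rfl).elim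
  | .inl (some _), .inl (some _), _, h => h
  | .inl (some _), .inr _, _, h => h

theorem doubledGraph_withSource_adj_insert [DecidableEq V] (E : Digraph V) (R : Finset V) (z : V) :
    ∀ x, (doubledGraph (withSource E (insert z R))).Adj (.inl none) x ↔
      (doubledGraph (withSource E R)).Adj (.inl none) x ∨
        (doubledGraph (withSource E {z})).Adj (.inl none) x
  | .inl none => (or_self_iff (a := False)).symm
  | .inl (some v) => by
    change v ∈ insert z R ↔ v ∈ R ∨ v ∈ ({z} : Finset V)
    simp [or_comm]
  | .inr u => by
    change (none = some u ∨ u ∈ insert z R) ↔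
      (none = some u ∨ u ∈ R) ∨ (none = some u ∨ u ∈ ({z} : Finset V))
    simp [or_comm]

theorem sourceCopies_insert [Fintype V] [DecidableEq V] (E : Digraph V) (R : Finset V) (z : V) :
    sourceCopies (doubledGraph (withSource E (insert z R))) (.inl none) =
      sourceCopies (doubledGraph (withSource E R)) (.inl none) ∪
        sourceCopies (doubledGraph (withSource E {z})) (.inl none) := by
  ext y
  simp only [Finset.mem_union, mem_sourceCopies, doubledGraph_withSource_adj_insert, or_and_right,
    exists_or]

theorem weightedCount_eq_sum [Fintype V] [DecidableEq V] (F : Finset (Option V ⊕ V)) :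
    weightedCount F = ∑ x ∈ F, weight x := by
  simp [weightedCount]

theorem weight_nonneg : ∀ x : Option V ⊕ V, 0 ≤ weight x
  | .inl _ => le_rfl
  | .inr _ => zero_le_one

end Readers

end Cascade

theorem proposition4 {V : Type*} [Fintype V] [DecidableEq V] (E : Digraph V)
    (p : Cascade.SuccessProb (Option V)) (r : V → unitInterval)
    (hindep : Cascade.OrderIndependent (Cascade.withSource E Finset.univ) p)
    (hdec : Cascade.Decreasing (Cascade.withSource E Finset.univ) p)
    (o : Cascade.AttemptOrder (Option V ⊕ V)) :
    Cascade.IsSubmodular (Cascade.expectedReaders E p r o) := by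
  open Cascade in
  have hi := orderIndependent_doubled hindep
  have hd := decreasing_doubled hdec
  set m := (graphModel _ _ hi hd).splitSource (.inl none)
  set f : Finset V → ℝ := fun R => m.value
    (fun T => ∑ y ∈ T, Sum.elim (fun _ => 0) weight y) ∅
    (sourceCopies (doubledGraph (withSource E R)) (.inl none) ∪ {.inr (.inl none)}) with hf
  have key : expectedReaders E p r o = fun B => subsetExp B (fun v => r v) f := by
    funext B
    -- `expectedReaders` is by definition an expectation over `activeLaw`.
    change pmfExp (activeLaw E p r o B) weightedCount = _
    rw [activeLaw, pmfExp_bind, pmfExp_bernoulliSubset, funext weightedCount_eq_sum]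
    congr 1
    funext R
    exact pmfExp_finalLaw_eq_value o hi hd
      (doubledGraph_mono (withSource_mono E (Finset.subset_univ R)))
      (doubledGraph_withSource_adj E _ R) weight
  rw [key]
  refine isSubmodular_subsetExp (fun v => (r v).2.1) (fun v => (r v).2.2) fun S T z hST => ?_
  simp only [hf, sourceCopies_insert, Finset.union_right_comm _ _ {Sum.inr (Sum.inl none)}]
  refine m.value_union_sub_le (fun y => ?_) _ (Finset.union_subset_union_left
    (sourceCopies_mono fun x => doubledGraph_mono (withSource_mono E hST) _ x))
  rcases y with _ | x
  · exact le_rfl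
  · exact weight_nonneg x
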